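/- For a finite simple graph $G$, write $|G|$ for its number of vertices and let $S(G)$ be the set of real symmetric matrices $A=(a_{ij})$, with rows and columns indexed by the vertices of $G$, such that for all $i\ne j$ one has $a_{ij}\ne 0$ if and only if $i$ and $j$ are adjacent in $G$ (the diagonal entries are unrestricted). Let $q(A)$ denote the number of distinct eigenvalues of $A$, and put $q(G)=\min\{q(A) : A\in S(G)\}$. The join $G\vee H$ is the graph obtained from the disjoint union of $G$ and $H$ by adding all edges with one endpoint in $G$ and one endpoint in $H$. Theorem. Let $G$ and $H$ be connected finite simple graphs (each with at least one vertex). If $k$ is a positive integer and $|G|\le |H|\le k|G|+k+1$, then $$q(G\vee H)\le k+1.$$ In particular, for any connected graphs $G$ and $H$ with $\max\{|G|,|H|\}\ne 1$, $$q(G\vee H)\le\left\lceil\frac{|G|+|H|}{\min\{|G|,|H|\}+1}\right\rceil.$$ -/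

import Mathlib

namespace GraphJoin

/-- The join `G ∨ H`: the disjoint union of `G` and `H` together with all edges having one
endpoint in `G` and one endpoint in `H`. -/
def join {V W : Type*} (G : SimpleGraph V) (H : SimpleGraph W) : SimpleGraph (V ⊕ W) where
  Adj
    | Sum.inl v, Sum.inl v' => G.Adj v v'
    | Sum.inr w, Sum.inr w' => H.Adj w w'
    | Sum.inl _, Sum.inr _ => True
    | Sum.inr _, Sum.inl _ => True
  symm := ⟨by
    rintro (v | w) (v' | w') h
    · exact G.adj_symm h
    · trivial
    · trivial
    · exact H.adj_symm h⟩
  loopless := ⟨by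
    rintro (v | w) h
    · exact G.irrefl h
    · exact H.irrefl h⟩

/-- The set `S(G)` of real symmetric matrices whose off-diagonal `(i, j)` entry is nonzero
exactly when `i` and `j` are adjacent in `G`; the diagonal is unrestricted. -/
def matricesOf {V : Type*} (G : SimpleGraph V) : Set (Matrix V V ℝ) :=
  {A | A.IsSymm ∧ ∀ i j, i ≠ j → (A i j ≠ 0 ↔ G.Adj i j)}

/-- The number `q(A)` of distinct eigenvalues of a real symmetric matrix (all of which are real). -/
noncomputable def numEigenvalues {V : Type*} [Fintype V] [DecidableEq V]
    (A : Matrix V V ℝ) : ℕ :=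
  {μ : ℝ | Module.End.HasEigenvalue (Matrix.toLin' A) μ}.ncard

/-- The minimum number `q(G)` of distinct eigenvalues of a matrix in `S(G)`. -/
noncomputable def q {V : Type*} [Fintype V] [DecidableEq V] (G : SimpleGraph V) : ℕ :=
  sInf (numEigenvalues '' matricesOf G)

/-- `S(G)` is nonempty, so the infimum defining `q` is an attained minimum. -/
theorem matricesOf_nonempty {V : Type*} (G : SimpleGraph V) : (matricesOf G).Nonempty := by
  classical
  refine ⟨G.adjMatrix ℝ, SimpleGraph.isSymm_adjMatrix G, fun i j _ => ?_⟩
  simp [SimpleGraph.adjMatrix_apply]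

/-- The eigenvalues form a finite set, so `numEigenvalues` is their true number. -/
theorem finite_eigenvalues {V : Type*} [Fintype V] [DecidableEq V] (A : Matrix V V ℝ) :
    {μ : ℝ | Module.End.HasEigenvalue (Matrix.toLin' A) μ}.Finite :=
  Module.End.finite_hasEigenvalue (Matrix.toLin' A)

end GraphJoin

/-! ### Simultaneous nonvanishing of analytic functions. -/

namespace GraphJoin

open Finset Filter Topology Matrix

/-! The spectrum is prescribed first and the graph pattern imposed afterwards. `exists_coupling`
builds a symmetric matrix with diagonal blocks `diag a`, `diag b` and off-diagonal block `T`, all of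
whose eigenvalues lie in `{0, …, k}`. It is a direct sum of arrow matrices, one star per vertex of
`G`, and of 1×1 blocks. Stars hold at most `k` leaves each, and at most `k + 1` integers serve as
1×1 blocks, hence the bound `k|G| + k + 1`; each star needs a leaf, hence `|G| ≤ |H|`.

Conjugating by an orthogonal `U ⊕ R` preserves the spectrum. It remains to have `U diag(a) Uᵀ` in
`S(G)`, `R diag(b) Rᵀ` in `S(H)` and `U T Rᵀ` without zero entries. `exists_generic_orthogonal`
supplies this because `a` and `b` are injective: for small edge weights the implicit function
theorem corrects the diagonal so that the spectrum stays fixed, and the eigenvectors depend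
analytically on the weights. An entry of `U y` does not vanish identically, since weights supported
on a path up to the support of `y` make it nonzero (`mulVec_ne_zero_of_path`). Generic weights then
avoid all zeros at once. -/

/-- Finitely many analytic functions, none of them identically zero on a connected open set, have a
common point where none vanishes. -/
theorem exists_forall_ne_zero_of_analyticOnNhd {E ι : Type*} [NormedAddCommGroup E]
    [NormedSpace ℝ E] {B : Set E} (hBo : IsOpen B) (hBc : IsPreconnected B) (hBn : B.Nonempty)
    (s : Finset ι) (f : ι → E → ℝ) (hf : ∀ i ∈ s, AnalyticOnNhd ℝ (f i) B)
    (hne : ∀ i ∈ s, ∃ x ∈ B, f i x ≠ 0) : ∃ x ∈ B, ∀ i ∈ s, f i x ≠ 0 := by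
  classical
  induction s using Finset.induction_on with
  | empty => exact ⟨hBn.some, hBn.some_mem, by simp⟩
  | insert a s ha ih =>
    obtain ⟨x, hx, hxs⟩ := ih (fun i hi => hf i (mem_insert_of_mem hi))
      (fun i hi => hne i (mem_insert_of_mem hi))
    obtain ⟨z, hz, hza⟩ := hne a (mem_insert_self a s)
    have hev : ∀ᶠ x' in 𝓝 x, x' ∈ B ∧ ∀ i ∈ s, f i x' ≠ 0 := by
      refine (show ∀ᶠ x' in 𝓝 x, x' ∈ B from hBo.mem_nhds hx).and ?_
      rw [Filter.eventually_all_finset]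
      intro i hi
      exact (hf i (mem_insert_of_mem hi) x hx).continuousAt.eventually_ne (hxs i hi)
    -- The functions in `s` stay nonzero near `x`, so failure would make `f a` vanish near `x`,
    -- hence on all of `B`.
    by_contra! hcon
    refine hza ((hf a (mem_insert_self a s)).eqOn_zero_of_preconnected_of_eventuallyEq_zero hBc hx
      ?_ hz)
    filter_upwards [hev] with x' hx'
    obtain ⟨i, hi, hi0⟩ := hcon x' hx'.1
    rcases mem_insert.1 hi with rfl | his
    · exact hi0
    · exact absurd hi0 (hx'.2 i his)

/-! ### Isospectral deformation of a diagonal matrix. -/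

section Isospectral

variable {V : Type*} [Fintype V] [DecidableEq V]

open Classical in
/-- The symmetric matrix with diagonal `d` and edge weights `w` on the graph `G`. -/
noncomputable def weightMatrix (G : SimpleGraph V) (d : V → ℝ) (w : Sym2 V → ℝ) : Matrix V V ℝ :=
  Matrix.of fun i j => if i = j then d i else if G.Adj i j then w s(i, j) else 0

omit [Fintype V] in
theorem weightMatrix_isSymm (G : SimpleGraph V) (d : V → ℝ) (w : Sym2 V → ℝ) :
    (weightMatrix G d w).IsSymm := by
  ext i j
  by_cases h : i = j
  · subst h; rfl
  · by_cases ha : G.Adj i j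
    · simp [weightMatrix, h, Ne.symm h, ha, ha.symm, Sym2.eq_swap (a := i)]
    · simp [weightMatrix, h, Ne.symm h, ha, mt G.adj_symm ha]

omit [Fintype V] in
theorem weightMatrix_mem (G : SimpleGraph V) (d : V → ℝ) (w : Sym2 V → ℝ) (hw : ∀ e, w e ≠ 0) :
    weightMatrix G d w ∈ matricesOf G := by
  refine ⟨weightMatrix_isSymm G d w, fun i j hij => ?_⟩
  simp [weightMatrix, hij, hw]

/-- The matrix with unit diagonal and the off-diagonal entries of `Z`. -/
def unitDiag (Z : V → V → ℝ) : Matrix V V ℝ :=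
  Matrix.of fun i j => if i = j then 1 else Z i j

/-- The residual of the eigenvector equations `A P = P diag(lam)`, where `A` has diagonal
`lam + diag Z` and edge weights `w`, and `P` is `unitDiag Z`. -/
noncomputable def residual (G : SimpleGraph V) (lam : V → ℝ) (u : (Sym2 V → ℝ) × (V → V → ℝ)) :
    V → V → ℝ := fun i j =>
  ∑ l, weightMatrix G (fun i => lam i + u.2 i i) u.1 i l * unitDiag u.2 l j
    - lam j * unitDiag u.2 i j

theorem residual_contDiff (G : SimpleGraph V) (lam : V → ℝ) :
    ContDiff ℝ ⊤ (residual G lam) := by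
  classical
  refine contDiff_pi.2 fun i => contDiff_pi.2 fun j => ?_
  have h1 : ∀ i l, ContDiff ℝ ⊤ fun u : (Sym2 V → ℝ) × (V → V → ℝ) =>
      weightMatrix G (fun i => lam i + u.2 i i) u.1 i l := by
    intro i l
    simp only [weightMatrix, Matrix.of_apply]
    split_ifs <;> fun_prop
  have h2 : ∀ i l, ContDiff ℝ ⊤ fun u : (Sym2 V → ℝ) × (V → V → ℝ) => unitDiag u.2 i l := by
    intro i l
    simp only [unitDiag, Matrix.of_apply]
    split_ifs <;> fun_prop
  unfold residual
  fun_prop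

theorem residual_zero_left (G : SimpleGraph V) (lam : V → ℝ) (Z : V → V → ℝ) (i j : V) :
    residual G lam (0, Z) i j = if i = j then Z i i else (lam i + Z i i - lam j) * Z i j := by
  have h : ∀ l, weightMatrix G (fun i => lam i + Z i i) 0 i l * unitDiag Z l j
      = if i = l then (lam i + Z i i) * unitDiag Z i j else 0 := by
    intro l
    by_cases hl : i = l
    · subst hl; simp [weightMatrix]
    · simp [weightMatrix, hl]
  simp only [residual, h, Finset.sum_ite_eq, Finset.mem_univ, if_true]
  by_cases hij : i = j
  · subst hij; simp [unitDiag]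
  · simp only [unitDiag, Matrix.of_apply, hij, if_false]; ring

/-- At zero weights the residual decouples entrywise. Its linear part multiplies diagonal entries by
1 and the `(i, j)` entry by `lam i - lam j`, which is nonzero because the spectrum is simple. -/
theorem residual_isInvertible (G : SimpleGraph V) (lam : V → ℝ) (hlam : Function.Injective lam) :
    (fderiv ℝ (residual G lam) (0, 0) ∘L .inr ℝ (Sym2 V → ℝ) (V → V → ℝ)).IsInvertible := by
  have hc : ∀ i j, (if i = j then (1 : ℝ) else lam i - lam j) ≠ 0 := by
    intro i j
    split_ifs with h
    · exact one_ne_zero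
    · exact sub_ne_zero.2 fun h' => h (hlam h')
  let L : (V → V → ℝ) ≃L[ℝ] (V → V → ℝ) :=
    ContinuousLinearEquiv.piCongrRight fun i => ContinuousLinearEquiv.piCongrRight fun j =>
      ContinuousLinearEquiv.smulLeft (Units.mk0 _ (hc i j))
  refine ⟨L, ?_⟩
  have h1 : HasFDerivAt (fun Z : V → V → ℝ => residual G lam (0, Z))
      (fderiv ℝ (residual G lam) (0, 0) ∘L .inr ℝ (Sym2 V → ℝ) (V → V → ℝ)) 0 := by
    have hd : DifferentiableAt ℝ (residual G lam) (0, 0) :=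
      (residual_contDiff G lam).contDiffAt.differentiableAt (by simp)
    exact hd.hasFDerivAt.comp (0 : V → V → ℝ)
      (ContinuousLinearMap.inr ℝ (Sym2 V → ℝ) (V → V → ℝ)).hasFDerivAt
  have h2 : HasFDerivAt (fun Z : V → V → ℝ => residual G lam (0, Z))
      (L : (V → V → ℝ) →L[ℝ] (V → V → ℝ)) 0 := by
    refine hasFDerivAt_pi'' fun i => hasFDerivAt_pi'' fun j => ?_
    have hcoord : ∀ i j, HasFDerivAt (fun Z : V → V → ℝ => Z i j)
        ((ContinuousLinearMap.proj j : (V → ℝ) →L[ℝ] ℝ) ∘L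
          (ContinuousLinearMap.proj i : (V → V → ℝ) →L[ℝ] (V → ℝ))) 0 := fun i j =>
      ContinuousLinearMap.hasFDerivAt (((ContinuousLinearMap.proj j : (V → ℝ) →L[ℝ] ℝ) ∘L
          (ContinuousLinearMap.proj i : (V → V → ℝ) →L[ℝ] (V → ℝ))))
    have hL : ∀ Z i j, L Z i j = (if i = j then (1 : ℝ) else lam i - lam j) * Z i j :=
      fun _ _ _ => rfl
    simp only [residual_zero_left]
    by_cases hij : i = j
    · subst hij
      simp only [if_true]
      exact (hcoord i i).congr_fderiv (ContinuousLinearMap.ext fun Z => by simp [hL])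
    · simp only [hij, if_false]
      exact ((((hcoord i i).const_add (lam i)).sub_const (lam j)).fun_mul
        (hcoord i j)).congr_fderiv (ContinuousLinearMap.ext fun Z => by simp [hL, hij])
  exact h2.unique h1

end Isospectral
end GraphJoin

/-! ### Orthogonal eigenbases and genericity. -/

namespace GraphJoin

open Finset Filter Topology Matrix

section Orthogonal

variable {V : Type*} [Fintype V] [DecidableEq V]

/-- The matrix obtained from `P` by scaling its columns to unit length. -/
noncomputable def normalizeCols (P : Matrix V V ℝ) : Matrix V V ℝ :=
  Matrix.of fun i j => P i j / √(∑ l, P l j ^ 2)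

theorem normalizeCols_eq (P : Matrix V V ℝ) :
    normalizeCols P = P * diagonal fun j => (√(∑ l, P l j ^ 2))⁻¹ := by
  ext i j
  simp [normalizeCols, mul_diagonal, div_eq_mul_inv]

omit [DecidableEq V] in
theorem sum_sq_pos {P : Matrix V V ℝ} (hP : ∀ j, P j j ≠ 0) (j : V) : 0 < ∑ l, P l j ^ 2 :=
  sum_pos' (fun _ _ => sq_nonneg _) ⟨j, mem_univ j, by have := hP j; positivity⟩

theorem mul_normalizeCols {A P : Matrix V V ℝ} {lam : V → ℝ} (h : A * P = P * diagonal lam) :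
    A * normalizeCols P = normalizeCols P * diagonal lam := by
  rw [normalizeCols_eq, ← Matrix.mul_assoc, h, Matrix.mul_assoc, Matrix.mul_assoc,
    diagonal_mul_diagonal, diagonal_mul_diagonal]
  simp only [mul_comm]

/-- Symmetry of `A` makes the Gram matrix `Pᵀ * P` commute with `diagonal lam`; distinct entries of
`lam` then force it to be diagonal. -/
theorem normalizeCols_transpose_mul {A P : Matrix V V ℝ} {lam : V → ℝ} (hA : A.IsSymm)
    (hlam : Function.Injective lam) (h : A * P = P * diagonal lam) (hP : ∀ j, P j j ≠ 0) :
    (normalizeCols P)ᵀ * normalizeCols P = 1 := by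
  have hcomm : Pᵀ * P * diagonal lam = diagonal lam * (Pᵀ * P) := by
    have h' : Pᵀ * A = diagonal lam * Pᵀ := by
      simpa [transpose_mul, hA.eq] using congrArg transpose h
    rw [Matrix.mul_assoc, ← h, ← Matrix.mul_assoc, h', Matrix.mul_assoc]
  ext i j
  by_cases hij : i = j
  · subst hij
    have hpos := sum_sq_pos hP i
    have : ∀ x, normalizeCols P x i * normalizeCols P x i
        = P x i ^ 2 / ∑ l, P l i ^ 2 := by
      intro x
      rw [normalizeCols, Matrix.of_apply, div_mul_div_comm, Real.mul_self_sqrt hpos.le, sq]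
    rw [mul_apply, one_apply_eq]
    simp only [transpose_apply, this]
    rw [← sum_div, div_self hpos.ne']
  · have h0 : (Pᵀ * P) i j = 0 := by
      have := congrFun (congrFun hcomm i) j
      rw [mul_diagonal, diagonal_mul] at this
      have hne : lam j - lam i ≠ 0 := sub_ne_zero.2 fun h' => hij (hlam h').symm
      exact (mul_eq_zero.1 (by linarith : (Pᵀ * P) i j * (lam j - lam i) = 0)).resolve_right hne
    rw [normalizeCols_eq, transpose_mul, diagonal_transpose, Matrix.mul_assoc,
      ← Matrix.mul_assoc Pᵀ, ← Matrix.mul_assoc, mul_diagonal, diagonal_mul, h0, one_apply_ne hij]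
    simp

/-- If the matrix `A` splits into an irreducible tridiagonal block along the path `p 0, …, p n`
and a diagonal block off the path, then the first entry of an orthogonal combination of its
eigenvectors is governed by the eigenvector of index `p n`. -/
theorem mulVec_ne_zero_of_path {A U : Matrix V V ℝ} {lam : V → ℝ}
    (hU : Uᵀ * U = 1) (hAU : A * U = U * diagonal lam) (hUd : ∀ j, U j j ≠ 0)
    {p : ℕ → V} {n : ℕ} (hne : ∀ k < n, A (p k) (p (k + 1)) ≠ 0)
    (hrow : ∀ k < n, ∀ l, A (p k) l ≠ 0 → l = p k ∨ l = p (k + 1) ∨ ∃ k', k' + 1 = k ∧ l = p k')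
    (hoff : ∀ j, (∀ k ≤ n, j ≠ p k) → ∀ l, l ≠ j → A j l = 0)
    (hdiag : ∀ i j, i ≠ j → A j j ≠ lam i)
    {y : V → ℝ} (hy0 : ∀ k < n, y (p k) = 0) (hyn : y (p n) ≠ 0) : (U *ᵥ y) (p 0) ≠ 0 := by
  have hentry : ∀ i j, ∑ l, A i l * U l j = U i j * lam j := by
    intro i j
    have h := congrFun (congrFun hAU i) j
    rwa [mul_apply, mul_diagonal] at h
  have hU' : U * Uᵀ = 1 := mul_eq_one_comm.1 hU
  have hrow0 : ∀ j, (∀ k ≤ n, j ≠ p k) → ∀ i, i ≠ j → U j i = 0 := by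
    intro j hj i hij
    have h1 := hentry j i
    rw [sum_eq_single j (fun l _ hl => by rw [hoff j hj l hl, zero_mul])
      (fun h => absurd (mem_univ j) h)] at h1
    exact (mul_eq_zero.1 (by linarith : (A j j - lam i) * U j i = 0)).resolve_left
      (sub_ne_zero.2 (hdiag i j hij))
  -- Row `j` is supported at `j` alone, so orthogonality of the rows clears the rest of column `j`.
  have hcol0 : ∀ j, (∀ k ≤ n, j ≠ p k) → ∀ v, v ≠ j → U v j = 0 := by
    intro j hj v hv
    have h1 := congrFun (congrFun hU' v) j
    rw [mul_apply, one_apply_ne hv, sum_eq_single j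
      (fun l _ hl => by rw [transpose_apply, hrow0 j hj l hl, mul_zero])
      (fun h => absurd (mem_univ j) h)] at h1
    exact (mul_eq_zero.1 h1).resolve_right (hUd j)
  have hUy : (U *ᵥ y) (p 0) = U (p 0) (p n) * y (p n) := by
    rw [mulVec, dotProduct]
    refine sum_eq_single _ (fun j _ hj => ?_) (fun h => absurd (mem_univ _) h)
    by_cases hon : ∃ k ≤ n, j = p k
    · obtain ⟨k, hk, rfl⟩ := hon
      rw [hy0 k (lt_of_le_of_ne hk fun h => hj (by rw [h])), mul_zero]
    · push Not at hon
      rw [hcol0 j hon (p 0) (hon 0 (Nat.zero_le n)).symm, zero_mul]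
  rw [hUy]
  refine mul_ne_zero (fun h0 => hUd (p n) ?_) hyn
  -- A zero at `p 0` propagates along the path by the three-term recurrence, up to the nonzero
  -- diagonal entry.
  suffices ∀ k, k ≤ n → U (p k) (p n) = 0 from this n le_rfl
  intro k
  induction k using Nat.strong_induction_on with
  | _ k ih =>
    intro hk
    rcases k with _ | k
    · exact h0
    · have h1 := hentry (p k) (p n)
      rw [ih k (Nat.lt_succ_self k) (by omega), zero_mul, sum_eq_single (p (k + 1))
        (fun l _ hl => ?_) (fun h => absurd (mem_univ _) h)] at h1
      · exact (mul_eq_zero.1 h1).resolve_left (hne k (by omega))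
      · by_cases hA : A (p k) l = 0
        · rw [hA, zero_mul]
        · rcases hrow k (by omega) l hA with rfl | rfl | ⟨k', rfl, rfl⟩
          · rw [ih k (by omega) (by omega), mul_zero]
          · exact absurd rfl hl
          · rw [ih k' (by omega) (by omega), mul_zero]

omit [Fintype V] [DecidableEq V] in
/-- In a connected graph, a path leads from any vertex to the support of a nonzero vector. -/
theorem exists_path_to_support {G : SimpleGraph V} (hG : G.Connected) (v : V) {y : V → ℝ}
    (hy : y ≠ 0) : ∃ (p : ℕ → V) (n : ℕ), p 0 = v ∧ Set.InjOn p {k | k ≤ n} ∧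
      (∀ k < n, G.Adj (p k) (p (k + 1))) ∧ (∀ k < n, y (p k) = 0) ∧ y (p n) ≠ 0 := by
  classical
  obtain ⟨u, hu⟩ := Function.ne_iff.1 hy
  obtain ⟨q, hq⟩ := (hG.preconnected v u).exists_isPath
  have hex : ∃ n, y (q.getVert n) ≠ 0 := ⟨q.length, by simpa using hu⟩
  have hle : Nat.find hex ≤ q.length := Nat.find_min' hex (by simpa using hu)
  refine ⟨q.getVert, Nat.find hex, by simp, fun a ha b hb hab => ?_, fun k hk => ?_,
    fun k hk => not_not.1 (Nat.find_min hex hk), Nat.find_spec hex⟩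
  · exact hq.getVert_injOn (show a ≤ q.length from le_trans ha hle)
      (show b ≤ q.length from le_trans hb hle) hab
  · exact q.adj_getVert_succ (lt_of_lt_of_le hk hle)

/-- A connected graph realises every simple spectrum by a matrix whose eigenbasis is generic with
respect to any prescribed finite family of nonzero vectors. -/
theorem exists_generic_orthogonal {ι : Type*} [Finite ι] {G : SimpleGraph V} (hG : G.Connected)
    {lam : V → ℝ} (hlam : Function.Injective lam) (y : ι → V → ℝ) (hy : ∀ i, y i ≠ 0) :
    ∃ U : Matrix V V ℝ, Uᵀ * U = 1 ∧ U * diagonal lam * Uᵀ ∈ matricesOf G ∧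
      ∀ i v, (U *ᵥ y i) v ≠ 0 := by
  classical
  have := Fintype.ofFinite ι
  have hcd : ContDiffAt ℝ ⊤ (residual G lam) ((0 : Sym2 V → ℝ), (0 : V → V → ℝ)) :=
    (residual_contDiff G lam).contDiffAt
  have hinv := residual_isInvertible G lam hlam
  let Z := hcd.implicitFunction (by simp) hinv
  have hZ0 : Z 0 = 0 := hcd.implicitFunction_apply_self (by simp) hinv
  have hZa : AnalyticAt ℝ Z 0 := (hcd.contDiffAt_implicitFunction (by simp) hinv).analyticAt
  have hres0 : residual G lam (0, 0) = 0 := by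
    ext i j; rw [residual_zero_left]; simp
  have hres : ∀ᶠ w in 𝓝 (0 : Sym2 V → ℝ), residual G lam (w, Z w) = 0 := by
    have := hcd.eventually_apply_implicitFunction (by simp) hinv
    rwa [hres0] at this
  -- This is the hypothesis `hdiag` of `mulVec_ne_zero_of_path`.
  have hgap : ∀ᶠ w in 𝓝 (0 : Sym2 V → ℝ), ∀ i j, i ≠ j → lam j + Z w j j ≠ lam i := by
    rw [eventually_all]; intro i
    rw [eventually_all]; intro j
    by_cases hij : i = j
    · simp [hij]
    · have hc : ContinuousAt (fun w => lam j + Z w j j) 0 := by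
        have h1 : ContinuousAt Z 0 := hZa.continuousAt
        have h2 : ContinuousAt (fun w => Z w j j) 0 :=
          continuousAt_pi.1 (continuousAt_pi.1 h1 j) j
        exact continuousAt_const.add h2
      have h0 : lam j + Z 0 j j ≠ lam i := by
        rw [hZ0]; simpa using fun h => hij (hlam h).symm
      filter_upwards [hc.eventually_ne h0] with w hw _ using hw
  obtain ⟨r, hr, hball⟩ := Metric.eventually_nhds_iff_ball.1
    (hres.and (hgap.and hZa.eventually_analyticAt))
  let U : (Sym2 V → ℝ) → Matrix V V ℝ := fun w => normalizeCols (unitDiag (Z w))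
  let A : (Sym2 V → ℝ) → Matrix V V ℝ := fun w => weightMatrix G (fun i => lam i + Z w i i) w
  have hPd : ∀ w j, unitDiag (Z w) j j ≠ 0 := by simp [unitDiag]
  have hAP : ∀ w ∈ Metric.ball 0 r, A w * unitDiag (Z w) = unitDiag (Z w) * diagonal lam := by
    intro w hw
    ext i j
    have h1 := congrFun (congrFun (hball w hw).1 i) j
    rw [mul_diagonal, mul_apply, mul_comm _ (lam j)]
    exact sub_eq_zero.1 h1
  have hUU : ∀ w ∈ Metric.ball 0 r, (U w)ᵀ * U w = 1 := fun w hw =>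
    normalizeCols_transpose_mul (weightMatrix_isSymm _ _ _) hlam (hAP w hw) (hPd w)
  have hAU : ∀ w ∈ Metric.ball 0 r, A w * U w = U w * diagonal lam := fun w hw =>
    mul_normalizeCols (hAP w hw)
  have hUd : ∀ w j, U w j j ≠ 0 := fun w j =>
    div_ne_zero (hPd w j) (Real.sqrt_pos.2 (sum_sq_pos (hPd w) j)).ne'
  let f : (ι × V) ⊕ Sym2 V → (Sym2 V → ℝ) → ℝ :=
    Sum.elim (fun iv w => (U w *ᵥ y iv.1) iv.2) (fun e w => w e)
  obtain ⟨w, hw, hfw⟩ : ∃ w ∈ Metric.ball (0 : Sym2 V → ℝ) r, ∀ a ∈ (univ : Finset _), f a w ≠ 0 := by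
    refine exists_forall_ne_zero_of_analyticOnNhd Metric.isOpen_ball
      (convex_ball _ _).isPreconnected ⟨0, Metric.mem_ball_self hr⟩ univ f ?_ ?_
    · rintro (⟨i, v⟩ | e) - w hw
      · refine ContDiffAt.analyticAt ?_
        have hZc : ContDiffAt ℝ ⊤ Z w := (hball w hw).2.2.contDiffAt
        have hPc : ∀ i j, ContDiffAt ℝ ⊤ (fun w => unitDiag (Z w) i j) w := by
          intro i j
          simp only [unitDiag, Matrix.of_apply]
          split_ifs
          · exact contDiffAt_const
          · exact contDiffAt_pi.1 (contDiffAt_pi.1 hZc i) j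
        refine ContDiffAt.sum fun j _ => ContDiffAt.mul ?_ contDiffAt_const
        refine (hPc v j).div (ContDiffAt.sqrt (ContDiffAt.sum fun l _ => (hPc l j).pow 2) ?_) ?_
        · exact (sum_sq_pos (hPd w) j).ne'
        · exact (Real.sqrt_pos.2 (sum_sq_pos (hPd w) j)).ne'
      · exact (ContinuousLinearMap.proj (R := ℝ) (φ := fun _ : Sym2 V => ℝ) e).analyticAt w
    · have hsmall : ∀ w : Sym2 V → ℝ, (∀ e, w e = r / 2 ∨ w e = 0) → w ∈ Metric.ball 0 r := by
        intro w h
        rw [mem_ball_zero_iff, pi_norm_lt_iff hr]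
        intro e
        rcases h e with h | h <;> rw [h, Real.norm_eq_abs]
        · rw [abs_of_pos (half_pos hr)]; linarith
        · simpa using hr
      rintro (⟨i, v⟩ | e) -
      · obtain ⟨p, n, rfl, hinj, hadj, hy0, hyn⟩ := exists_path_to_support hG v (hy i)
        -- With weights only on the path, `A w` is tridiagonal along it and diagonal elsewhere.
        let w : Sym2 V → ℝ := fun e => if ∃ k < n, e = s(p k, p (k + 1)) then r / 2 else 0
        have hw : w ∈ Metric.ball 0 r := hsmall w fun e => ite_eq_or_eq _ _ _
        have hedge : ∀ i j, i ≠ j → A w i j ≠ 0 → ∃ k < n, s(i, j) = s(p k, p (k + 1)) := by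
          intro i j hij hA
          by_contra hno
          refine hA ?_
          simp only [A, weightMatrix, Matrix.of_apply, hij, if_false, w, hno, ite_self]
        refine ⟨w, hw, mulVec_ne_zero_of_path (hUU w hw) (hAU w hw) (hUd w) ?_ ?_ ?_ ?_ hy0 hyn⟩
        · intro k hk
          have hex : ∃ k' < n, s(p k, p (k + 1)) = s(p k', p (k' + 1)) := ⟨k, hk, rfl⟩
          simp only [A, weightMatrix, Matrix.of_apply, (hadj k hk).ne, hadj k hk, if_true, if_false,
            w, if_pos hex]
          exact (half_pos hr).ne'
        · intro k hk l hA
          by_cases hl : p k = l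
          · exact Or.inl hl.symm
          · obtain ⟨k', hk', he⟩ := hedge _ _ hl hA
            rcases Sym2.eq_iff.1 he with ⟨h1, h2⟩ | ⟨h1, h2⟩
            · have : k = k' := hinj hk.le hk'.le h1
              subst this
              exact Or.inr (Or.inl h2)
            · have : k = k' + 1 := hinj hk.le hk' h1
              exact Or.inr (Or.inr ⟨k', this.symm, h2⟩)
        · intro j hj l hl
          by_contra hA
          obtain ⟨k', hk', he⟩ := hedge _ _ hl.symm hA
          rcases Sym2.eq_iff.1 he with ⟨h1, h2⟩ | ⟨h1, h2⟩
          · exact hj k' hk'.le h1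
          · exact hj (k' + 1) hk' h1
        · intro i j hij
          simpa [A, weightMatrix] using (hball w hw).2.1 i j hij
      · exact ⟨fun _ => r / 2, hsmall _ fun _ => Or.inl rfl, (half_pos hr).ne'⟩
  refine ⟨U w, hUU w hw, ?_, fun i v => hfw (Sum.inl (i, v)) (mem_univ _)⟩
  have hA : U w * diagonal lam * (U w)ᵀ = A w := by
    rw [← hAU w hw, Matrix.mul_assoc, mul_eq_one_comm.1 (hUU w hw), Matrix.mul_one]
  rw [hA]
  exact weightMatrix_mem G _ w fun e => hfw (Sum.inr e) (mem_univ _)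

end Orthogonal
end GraphJoin

/-! ### Arrow matrices with prescribed spectrum. -/

namespace GraphJoin

open Finset Matrix Polynomial

theorem degree_sub_lt_of_monic_of_nextCoeff_eq {R : Type*} [Ring R] {p q : R[X]} {n : ℕ}
    (hp : p.Monic) (hq : q.Monic) (hpn : p.natDegree = n + 1) (hqn : q.natDegree = n + 1)
    (h : p.nextCoeff = q.nextCoeff) : (p - q).degree < n := by
  rw [degree_lt_iff_coeff_zero]
  intro m hm
  rw [coeff_sub, sub_eq_zero]
  rw [nextCoeff_of_natDegree_pos (by omega), nextCoeff_of_natDegree_pos (by omega), hpn, hqn] at h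
  have hp1 := hp.coeff_natDegree
  have hq1 := hq.coeff_natDegree
  rw [hpn] at hp1
  rw [hqn] at hq1
  obtain rfl | rfl | hm2 : m = n ∨ m = n + 1 ∨ n + 1 < m := by omega
  · exact h
  · rw [hp1, hq1]
  · rw [coeff_eq_zero_of_natDegree_lt (by omega), coeff_eq_zero_of_natDegree_lt (by omega)]

section Arrow

variable {ι : Type*} [DecidableEq ι]

/-- Partial fractions for the secular function of an arrow matrix with prescribed spectrum. -/
theorem secular_identity (S : Finset ι) {θ μ : ι → ℝ} (hμ : Set.InjOn μ S) (c x : ℝ)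
    (hx : ∀ j ∈ S, x ≠ μ j) :
    (x - c) * ∏ j ∈ S, (x - θ j) = (∏ j ∈ S, (x - μ j)) * (x - (c + ∑ j ∈ S, (θ j - μ j)) +
      ∑ j ∈ S, ((μ j - c) * ∏ l ∈ S, (μ j - θ l)) * (∏ l ∈ S.erase j, (μ j - μ l))⁻¹ *
        (x - μ j)⁻¹) := by
  set a := c + ∑ j ∈ S, (θ j - μ j) with ha
  -- The centre `a` matches the second coefficients, so `p` has degree below `#S` and is determined
  -- by its values at the `μ j`.
  let p : ℝ[X] := (X - C c) * ∏ j ∈ S, (X - C (θ j)) - (X - C a) * ∏ j ∈ S, (X - C (μ j))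
  have hdeg : p.degree < #S := by
    have hmon : ∀ (b : ℝ) (ν : ι → ℝ), ((X - C b) * ∏ j ∈ S, (X - C (ν j))).Monic := fun b ν =>
      (monic_X_sub_C b).mul (monic_prod_X_sub_C ν S)
    have hnat : ∀ (b : ℝ) (ν : ι → ℝ),
        ((X - C b) * ∏ j ∈ S, (X - C (ν j))).natDegree = #S + 1 := fun b ν => by
      rw [(monic_X_sub_C b).natDegree_mul (monic_prod_X_sub_C ν S), natDegree_X_sub_C,
        natDegree_finsetProd_X_sub_C_eq_card, add_comm]
    refine degree_sub_lt_of_monic_of_nextCoeff_eq (hmon c θ) (hmon a μ) (hnat c θ) (hnat a μ) ?_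
    rw [(monic_X_sub_C c).nextCoeff_mul (monic_prod_X_sub_C θ S),
      (monic_X_sub_C a).nextCoeff_mul (monic_prod_X_sub_C μ S), nextCoeff_X_sub_C,
      nextCoeff_X_sub_C, prod_X_sub_C_nextCoeff, prod_X_sub_C_nextCoeff, ha, sum_sub_distrib]
    ring
  have hev : ∀ z, p.eval z = (z - c) * ∏ j ∈ S, (z - θ j) - (z - a) * ∏ j ∈ S, (z - μ j) := by
    intro z; simp [p, eval_prod]
  have h1 := congrArg (eval x) (Lagrange.eq_interpolate hμ hdeg)
  rw [Lagrange.eval_interpolate_not_at_node _ hx, hev, Lagrange.eval_nodal] at h1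
  rw [mul_add, ← sub_eq_iff_eq_add', mul_comm _ (x - a), h1]
  congr 1
  refine sum_congr rfl fun j hj => ?_
  rw [hev, prod_eq_zero (f := fun l => μ j - μ l) hj (sub_self (μ j)), Lagrange.nodalWeight, prod_inv_distrib]
  ring

/-- An arrow system with centre `c + ∑ (θ j - μ j)` and leaves `μ j` interlacing `c` and `θ j` has,
for suitable nonzero couplings, no eigenvalue outside `{c} ∪ {θ j}`. -/
theorem exists_arrow (S : Finset ι) {θ μ : ι → ℝ} {c : ℝ} (hμ : Set.InjOn μ S)
    (hc : ∀ j ∈ S, c < μ j) (hθ : ∀ j ∈ S, μ j < θ j)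
    (hlt : ∀ j ∈ S, ∀ l ∈ S, j ≠ l → θ j < μ l ∨ θ l < μ j) :
    ∃ σ : ι → ℝ, (∀ j ∈ S, σ j ≠ 0) ∧ ∀ x, x ≠ c → (∀ j ∈ S, x ≠ θ j) → ∀ (g : ℝ) (h : ι → ℝ),
      (c + ∑ j ∈ S, (θ j - μ j)) * g + ∑ j ∈ S, σ j * h j = x * g →
      (∀ j ∈ S, σ j * g + μ j * h j = x * h j) → g = 0 ∧ ∀ j ∈ S, h j = 0 := by
  -- Residues of the secular function; interlacing makes them negative, so `-τ j` can serve as a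
  -- squared coupling.
  let τ : ι → ℝ := fun j =>
    ((μ j - c) * ∏ l ∈ S, (μ j - θ l)) * (∏ l ∈ S.erase j, (μ j - μ l))⁻¹
  have hτ : ∀ j ∈ S, 0 < -τ j := by
    intro j hj
    have h1 : -τ j = (μ j - c) * (θ j - μ j) *
        ∏ l ∈ S.erase j, ((μ j - θ l) * (μ j - μ l)⁻¹) := by
      simp only [τ]
      rw [← mul_prod_erase S _ hj, prod_mul_distrib, prod_inv_distrib]
      ring
    rw [h1]
    refine mul_pos (mul_pos (sub_pos.2 (hc j hj)) (sub_pos.2 (hθ j hj))) (prod_pos fun l hl => ?_)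
    have hlS := mem_of_mem_erase hl
    rcases hlt j hj l hlS (ne_of_mem_erase hl).symm with h | h
    · exact mul_pos_of_neg_of_neg (by linarith [hθ j hj, hθ l hlS])
        (inv_lt_zero.2 (by linarith [hθ j hj]))
    · exact mul_pos (by linarith) (inv_pos.2 (by linarith [hθ l hlS]))
  refine ⟨fun j => √(-τ j), fun j hj => (Real.sqrt_pos.2 (hτ j hj)).ne', ?_⟩
  intro x hxc hxθ g h hg hh
  simp only at hg hh
  have hσ : ∀ j ∈ S, √(-τ j) ≠ 0 := fun j hj => (Real.sqrt_pos.2 (hτ j hj)).ne'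
  by_cases hx : ∀ j ∈ S, x ≠ μ j
  · have hhj : ∀ j ∈ S, h j = √(-τ j) * g * (x - μ j)⁻¹ := by
      intro j hj
      rw [eq_mul_inv_iff_mul_eq₀ (sub_ne_zero.2 (hx j hj))]
      linarith [hh j hj]
    have hg0 : g = 0 := by
      have hid := secular_identity S (θ := θ) hμ c x hx
      have hne : (x - c) * ∏ j ∈ S, (x - θ j) ≠ 0 :=
        mul_ne_zero (sub_ne_zero.2 hxc) (prod_ne_zero_iff.2 fun j hj => sub_ne_zero.2 (hxθ j hj))
      rw [hid] at hne
      refine (mul_eq_zero.1 ?_).resolve_left (right_ne_zero_of_mul hne)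
      have : ∑ j ∈ S, √(-τ j) * h j = -((∑ j ∈ S, τ j * (x - μ j)⁻¹) * g) := by
        rw [sum_mul, ← sum_neg_distrib]
        refine sum_congr rfl fun j hj => ?_
        rw [hhj j hj]
        linear_combination (g * (x - μ j)⁻¹) * Real.mul_self_sqrt (hτ j hj).le
      rw [this] at hg
      simp only [τ] at hg
      linarith
    exact ⟨hg0, fun j hj => by rw [hhj j hj, hg0]; ring⟩
  -- At a leaf value, row `j` kills `g`, the other leaf rows kill their `h l`, and the centre row
  -- then kills `h j`.
  · push Not at hx
    obtain ⟨j, hj, rfl⟩ := hx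
    have hg0 : g = 0 := (mul_eq_zero.1 (by linarith [hh j hj] : √(-τ j) * g = 0)).resolve_left
      (hσ j hj)
    have hl : ∀ l ∈ S, l ≠ j → h l = 0 := by
      intro l hl hlj
      have := hh l hl
      rw [hg0] at this
      exact (mul_eq_zero.1 (by linarith : (μ l - μ j) * h l = 0)).resolve_left
        (sub_ne_zero.2 fun h' => hlj (hμ hl hj h'))
    refine ⟨hg0, fun l hlS => ?_⟩
    by_cases hlj : l = j
    · subst hlj
      rw [hg0, sum_eq_single (f := fun j => √(-τ j) * h j) l (fun m hm hml => by
        rw [hl m hm hml, mul_zero]) (fun h' => absurd hj h')] at hg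
      exact (mul_eq_zero.1 (by linarith : √(-τ l) * h l = 0)).resolve_left (hσ l hj)
    · exact hl l hlS hlj

end Arrow
end GraphJoin

/-! ### The coupled matrix as a sum of stars. -/

namespace GraphJoin

open Finset Matrix

section Coupling

variable {V W : Type*} [Fintype V] [DecidableEq V] [Fintype W]

-- The ratio `1 / (k + 1)` beats any multiplier up to `k`, so the values strictly decrease in `idx`.
-- Star centres are of this form, with the number of leaves as multiplier.
omit [Fintype V] [DecidableEq V] in
theorem injective_mul_geometric {k : ℕ} {idx : V → ℕ} (hidx : Function.Injective idx)
    {n : V → ℕ} (hn : ∀ v, 0 < n v) (hnk : ∀ v, n v ≤ k) :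
    Function.Injective fun v => (n v : ℝ) * (1 / 2 * (1 / ((k : ℝ) + 1)) ^ idx v) := by
  have key : ∀ u v, idx u < idx v → (n v : ℝ) * (1 / 2 * (1 / ((k : ℝ) + 1)) ^ idx v)
      < (n u : ℝ) * (1 / 2 * (1 / ((k : ℝ) + 1)) ^ idx u) := by
    intro u v huv
    have hk : (0 : ℝ) < k + 1 := by positivity
    have hpos : 0 < (1 / ((k : ℝ) + 1)) ^ idx u := by positivity
    have h1 : (1 / ((k : ℝ) + 1)) ^ idx v ≤ (1 / ((k : ℝ) + 1)) ^ idx u * (1 / ((k : ℝ) + 1)) := by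
      rw [← pow_succ]
      refine pow_le_pow_of_le_one (by positivity) ?_ huv
      rw [div_le_one hk]; linarith [(Nat.cast_nonneg k : (0 : ℝ) ≤ k)]
    have h2 : (n v : ℝ) ≤ k := by exact_mod_cast hnk v
    have h3 : (1 : ℝ) ≤ n u := by exact_mod_cast hn u
    have h4 : (n v : ℝ) * (1 / ((k : ℝ) + 1)) < 1 := by
      rw [mul_one_div, div_lt_one hk]; linarith
    calc (n v : ℝ) * (1 / 2 * (1 / ((k : ℝ) + 1)) ^ idx v)
        ≤ (n v : ℝ) * (1 / 2 * ((1 / ((k : ℝ) + 1)) ^ idx u * (1 / ((k : ℝ) + 1)))) := by gcongr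
      _ = ((n v : ℝ) * (1 / ((k : ℝ) + 1))) * (1 / 2 * (1 / ((k : ℝ) + 1)) ^ idx u) := by ring
      _ < 1 * (1 / 2 * (1 / ((k : ℝ) + 1)) ^ idx u) := by gcongr
      _ ≤ (n u : ℝ) * (1 / 2 * (1 / ((k : ℝ) + 1)) ^ idx u) := by gcongr
  intro u v huv
  by_contra hne
  rcases lt_or_gt_of_ne (fun h => hne (hidx h)) with h | h
  · exact (key u v h).ne' huv
  · exact (key v u h).ne huv

/-- The vertices of `W` can be distributed over stars centred at the vertices of `V`, each with at
least one and at most `k` leaves in distinct slots, and at most `k + 1` isolated vertices. -/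
theorem exists_star_decomposition {k : ℕ} (hk : 0 < k) (hVW : Fintype.card V ≤ Fintype.card W)
    (hWV : Fintype.card W ≤ k * Fintype.card V + k + 1) :
    ∃ (Q : Finset (V × Fin k)) (s : ℕ), s ≤ k + 1 ∧ (∀ v, (v, ⟨0, hk⟩) ∈ Q) ∧
      Nonempty (W ≃ Q ⊕ Fin s) := by
  -- As many isolated vertices as allowed while keeping one leaf per star.
  let s := min (k + 1) (Fintype.card W - Fintype.card V)
  let Q₀ : Finset (V × Fin k) := univ.image fun v => (v, ⟨0, hk⟩)
  have hQ₀ : #Q₀ = Fintype.card V :=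
    (card_image_of_injective _ fun u v h => (Prod.mk.inj h).1).trans card_univ
  have hV : Fintype.card V ≤ k * Fintype.card V := Nat.le_mul_of_pos_left _ hk
  obtain ⟨Q, hQ, -, hcard⟩ := exists_subsuperset_card_eq (subset_univ Q₀)
    (n := Fintype.card W - s) (by omega)
    (by rw [card_univ, Fintype.card_prod, Fintype.card_fin, mul_comm]; omega)
  refine ⟨Q, s, min_le_left _ _, fun v => hQ (mem_image_of_mem _ (mem_univ v)),
    ⟨Fintype.equivOfCardEq ?_⟩⟩
  rw [Fintype.card_sum, Fintype.card_coe, Fintype.card_fin, hcard]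
  omega

/-- There are injective diagonals `a`, `b` and a nonzero coupling `T` for which the symmetric
matrix with blocks `diag a`, `T`, `Tᵀ`, `diag b` has all its eigenvalues in `{0, …, k}`. -/
theorem exists_coupling [Nonempty V] {k : ℕ} (hk : 0 < k) (hVW : Fintype.card V ≤ Fintype.card W)
    (hWV : Fintype.card W ≤ k * Fintype.card V + k + 1) :
    ∃ (a : V → ℝ) (b : W → ℝ) (T : Matrix V W ℝ), Function.Injective a ∧ Function.Injective b ∧
      (∃ v, T v ≠ 0) ∧ ∀ x : ℝ, (∀ t : ℕ, t ≤ k → x ≠ t) → ∀ (g : V → ℝ) (h : W → ℝ),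
        (∀ v, a v * g v + ∑ w, T v w * h w = x * g v) →
        (∀ w, ∑ v, T v w * g v + b w * h w = x * h w) → g = 0 ∧ h = 0 := by
  obtain ⟨Q, s, hs, hQ, ⟨e⟩⟩ := exists_star_decomposition (V := V) (W := W) hk hVW hWV
  let S : V → Finset (Fin k) := fun v => univ.filter fun j => (v, j) ∈ Q
  have hS : ∀ v j, j ∈ S v ↔ (v, j) ∈ Q := fun v j => by simp [S]
  let idx : V → ℕ := fun v => Fintype.equivFin V v
  have hidx : Function.Injective idx := Fin.val_injective.comp (Fintype.equivFin V).injective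
  let δ : V → ℝ := fun v => 1 / 2 * (1 / ((k : ℝ) + 1)) ^ idx v
  have hδ0 : ∀ v, 0 < δ v := fun v => by positivity
  have hδ1 : ∀ v, δ v < 1 := by
    intro v
    have : (1 / ((k : ℝ) + 1)) ^ idx v ≤ 1 := by
      refine pow_le_one₀ (by positivity) ?_
      rw [div_le_one (by positivity)]; linarith [(Nat.cast_nonneg k : (0 : ℝ) ≤ k)]
    simp only [δ]; linarith
  have hδ : Function.Injective δ := by
    simpa [δ] using injective_mul_geometric (k := k) hidx (n := fun _ => 1) (fun _ => one_pos)
      (fun _ => hk)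
  let θ : Fin k → ℝ := fun j => (j : ℕ) + 1
  -- The shift `δ v` lies strictly between 0 and 1: leaves interlace the integers, are never
  -- integers, and reveal both `j` and `v`.
  let μ : V → Fin k → ℝ := fun v j => θ j - δ v
  have harrow := fun v => exists_arrow (S v) (θ := θ) (μ := μ v) (c := 0)
    (fun i _ j _ h => Fin.ext (by simpa [μ, θ] using h))
    (fun j _ => by
      have : (0 : ℝ) ≤ (j : ℕ) := Nat.cast_nonneg _
      simp only [μ, θ]; linarith [hδ1 v])
    (fun j _ => by simp only [μ]; linarith [hδ0 v])
    (fun j _ l _ hjl => by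
      rcases lt_or_gt_of_ne hjl with h | h
      · have : ((j : ℕ) : ℝ) + 1 ≤ (l : ℕ) := by exact_mod_cast h
        left; simp only [μ, θ]; linarith [hδ1 v]
      · have : ((l : ℕ) : ℝ) + 1 ≤ (j : ℕ) := by exact_mod_cast h
        right; simp only [μ, θ]; linarith [hδ1 v])
  choose σ hσ0 hσ using harrow
  let T : Matrix V W ℝ := fun v w =>
    Sum.elim (fun q : Q => if q.1.1 = v then σ v q.1.2 else 0) (fun _ => 0) (e w)
  let b : W → ℝ := fun w => Sum.elim (fun q : Q => μ q.1.1 q.1.2) (fun t : Fin s => ((t : ℕ) : ℝ)) (e w)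
  refine ⟨fun v => 0 + ∑ j ∈ S v, (θ j - μ v j), b, T, ?_, ?_, ?_, ?_⟩
  · have : (fun v => 0 + ∑ j ∈ S v, (θ j - μ v j)) = fun v => ((#(S v) : ℕ) : ℝ) * δ v := by
      ext v; simp [μ]
    rw [this]
    refine injective_mul_geometric hidx (fun v => card_pos.2 ⟨_, (hS v _).2 (hQ v)⟩) fun v => ?_
    exact (card_le_univ _).trans (Fintype.card_fin k).le
  · have hfrac : ∀ (n n' : ℕ) (d d' : ℝ), 0 ≤ d → d < 1 → 0 ≤ d' → d' < 1 →
        (n : ℝ) - d = n' - d' → n = n' ∧ d = d' := by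
      intro n n' d d' h0 h1 h0' h1' h
      have h2 : n < n' + 1 := by exact_mod_cast (by linarith : (n : ℝ) < n' + 1)
      have h3 : n' < n + 1 := by exact_mod_cast (by linarith : (n' : ℝ) < n + 1)
      obtain rfl : n = n' := by omega
      exact ⟨rfl, by linarith⟩
    refine Function.Injective.comp ?_ e.injective
    rintro (⟨⟨v, j⟩, hq⟩ | t) (⟨⟨v', j'⟩, hq'⟩ | t') heq
    · have := hfrac (j + 1) (j' + 1) (δ v) (δ v') (hδ0 v).le (hδ1 v) (hδ0 v').le (hδ1 v')
        (by simpa [μ, θ] using heq)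
      obtain rfl := hδ this.2
      obtain rfl : j = j' := Fin.ext (by omega)
      rfl
    · have := hfrac (j + 1) t' (δ v) 0 (hδ0 v).le (hδ1 v) le_rfl one_pos
        (by simpa [μ, θ] using heq)
      exact absurd this.2 (hδ0 v).ne'
    · have := hfrac t (j' + 1) 0 (δ v') le_rfl one_pos (hδ0 v').le (hδ1 v')
        (by simpa [μ, θ] using heq)
      exact absurd this.2 (hδ0 v').ne
    · have := hfrac t t' 0 0 le_rfl one_pos le_rfl one_pos (by simpa using heq)
      rw [Fin.ext this.1]
  · obtain ⟨v⟩ := ‹Nonempty V›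
    refine ⟨v, fun h => hσ0 v ⟨0, hk⟩ ((hS v _).2 (hQ v)) ?_⟩
    simpa [T] using congrFun h (e.symm (Sum.inl ⟨(v, ⟨0, hk⟩), hQ v⟩))
  · intro x hx g h hg hh
    -- The default 0 is never used: `F` is only evaluated on `Q`.
    let F : V × Fin k → ℝ := fun q => if hq : q ∈ Q then h (e.symm (Sum.inl ⟨q, hq⟩)) else 0
    have hF : ∀ q (hq : q ∈ Q), F q = h (e.symm (Sum.inl ⟨q, hq⟩)) := fun q hq => dif_pos hq
    have hsum : ∀ v, ∑ w, T v w * h w = ∑ j ∈ S v, σ v j * F (v, j) := by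
      intro v
      rw [← e.symm.sum_comp, Fintype.sum_sum_type]
      have h1 : ∀ q : Q, T v (e.symm (Sum.inl q)) * h (e.symm (Sum.inl q))
          = if q.1.1 = v then σ v q.1.2 * F q.1 else 0 := by
        intro q
        rw [hF q.1 q.2]
        simp [T]
      have h2 : ∀ t : Fin s, T v (e.symm (Sum.inr t)) * h (e.symm (Sum.inr t)) = 0 := by
        intro t; simp [T]
      simp only [h1, h2, sum_const_zero, add_zero]
      rw [sum_coe_sort Q fun q => if q.1 = v then σ v q.2 * F q else 0, ← sum_filter]
      symm
      refine sum_bij (fun j _ => (v, j)) (fun j hj => by simpa [S] using hj)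
        (fun _ _ _ _ h => (Prod.mk.inj h).2) (fun q hq => ?_) (fun _ _ => rfl)
      obtain ⟨v', j⟩ := q
      obtain ⟨hQ', hv⟩ := mem_filter.1 hq
      obtain rfl : v' = v := hv
      exact ⟨j, (hS _ _).2 hQ', rfl⟩
    have hstar : ∀ v, g v = 0 ∧ ∀ j ∈ S v, F (v, j) = 0 := by
      intro v
      refine hσ v x (by simpa using hx 0 (Nat.zero_le k)) (fun j _ => ?_) (g v)
        (fun j => F (v, j)) ?_ fun j hj => ?_
      · simpa [θ] using hx (j + 1) j.2
      · rw [← hsum]; exact hg v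
      · have hq := (hS v j).1 hj
        have := hh (e.symm (Sum.inl ⟨(v, j), hq⟩))
        rw [← hF] at this
        simpa [T, b] using this
    refine ⟨funext fun v => (hstar v).1, funext fun w => ?_⟩
    obtain ⟨c, rfl⟩ := e.symm.surjective w
    rcases c with ⟨⟨v, j⟩, hq⟩ | t
    · rw [← hF]; exact (hstar v).2 j ((hS v j).2 hq)
    · have h1 := hh (e.symm (Sum.inr t))
      have h2 : x ≠ ((t : ℕ) : ℝ) := hx t (by omega)
      have h3 : ((t : ℕ) : ℝ) * h (e.symm (Sum.inr t)) = x * h (e.symm (Sum.inr t)) := by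
        simpa [T, b] using h1
      exact (mul_eq_zero.1 (by linarith :
        (x - (t : ℕ)) * h (e.symm (Sum.inr t)) = 0)).resolve_left (sub_ne_zero.2 h2)

end Coupling
end GraphJoin

/-! ### Assembling the matrix of the join. -/

namespace GraphJoin

open Finset Matrix

section Join

variable {V W : Type*} [Fintype V] [DecidableEq V] [Fintype W] [DecidableEq W]

theorem q_le_of_mem {G : SimpleGraph V} {A : Matrix V V ℝ} (hA : A ∈ matricesOf G) {n : ℕ}
    (h : numEigenvalues A ≤ n) : q G ≤ n :=
  (Nat.sInf_le (Set.mem_image_of_mem numEigenvalues hA)).trans h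

theorem numEigenvalues_le_of_forall {A : Matrix V V ℝ} {k : ℕ}
    (h : ∀ x : ℝ, (∀ t : ℕ, t ≤ k → x ≠ t) → ∀ z, A *ᵥ z = x • z → z = 0) :
    numEigenvalues A ≤ k + 1 := by
  have hsub : {μ : ℝ | Module.End.HasEigenvalue (Matrix.toLin' A) μ} ⊆
      ((range (k + 1)).image fun t : ℕ => (t : ℝ) : Finset ℝ) := by
    intro x hx
    obtain ⟨z, hz⟩ := Module.End.HasEigenvalue.exists_hasEigenvector hx
    by_contra hmem
    refine hz.2 (h x (fun t ht hxt => hmem ?_) z ?_)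
    · exact mem_coe.2 (mem_image.2 ⟨t, mem_range.2 (Nat.lt_succ_of_le ht), hxt.symm⟩)
    · simpa using hz.apply_eq_smul
  refine (Set.ncard_le_ncard hsub (finite_toSet _)).trans ?_
  rw [Set.ncard_coe_finset]
  exact card_image_le.trans (card_range _).le

omit [Fintype V] [DecidableEq V] [Fintype W] [DecidableEq W] in
theorem fromBlocks_mem_matricesOf_join {G : SimpleGraph V} {H : SimpleGraph W}
    {A : Matrix V V ℝ} {B : Matrix W W ℝ} {C : Matrix V W ℝ} (hA : A ∈ matricesOf G)
    (hB : B ∈ matricesOf H) (hC : ∀ v w, C v w ≠ 0) :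
    fromBlocks A C Cᵀ B ∈ matricesOf (join G H) := by
  refine ⟨hA.1.fromBlocks rfl hB.1, ?_⟩
  rintro (v | w) (v' | w') hne
  · exact hA.2 v v' fun h => hne (congrArg _ h)
  · exact iff_of_true (hC v w') trivial
  · exact iff_of_true (hC v' w) trivial
  · exact hB.2 w w' fun h => hne (congrArg _ h)

theorem exists_mem_matricesOf_join {G : SimpleGraph V} {H : SimpleGraph W} (hG : G.Connected)
    (hH : H.Connected) {k : ℕ} (hk : 0 < k) (hVW : Fintype.card V ≤ Fintype.card W)
    (hWV : Fintype.card W ≤ k * Fintype.card V + k + 1) :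
    ∃ M ∈ matricesOf (join G H), numEigenvalues M ≤ k + 1 := by
  have := hG.nonempty
  obtain ⟨a, b, T, ha, hb, ⟨i₀, hi₀⟩, hspec⟩ := exists_coupling (V := V) (W := W) hk hVW hWV
  -- One nonzero row of `T` suffices: `R` spreads it over all columns, so every column of `T * Rᵀ`
  -- is nonzero, and `U` then fills each of them.
  obtain ⟨R, hR, hRH, hRy⟩ := exists_generic_orthogonal hH hb (fun (_ : Unit) w => T i₀ w) fun _ => hi₀
  have hTR : ∀ w, (fun v => (T * Rᵀ) v w) ≠ 0 := by
    intro w h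
    refine hRy () w ?_
    refine Eq.trans ?_ (congrFun h i₀)
    simp only [mulVec, dotProduct, mul_apply, transpose_apply, mul_comm]
  obtain ⟨U, hU, hUG, hUy⟩ := exists_generic_orthogonal hG ha (fun w v => (T * Rᵀ) v w) hTR
  have hC : ∀ v w, (U * (T * Rᵀ)) v w ≠ 0 := fun v w => hUy w v
  refine ⟨_, fromBlocks_mem_matricesOf_join hUG hRH hC, numEigenvalues_le_of_forall ?_⟩
  intro x hx z hz
  let X : Matrix (V ⊕ W) (V ⊕ W) ℝ := fromBlocks U 0 0 R
  have hX : Xᵀ * X = 1 := by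
    simp [X, fromBlocks_transpose, fromBlocks_multiply, hU, hR]
  let M₀ : Matrix (V ⊕ W) (V ⊕ W) ℝ := fromBlocks (diagonal a) T Tᵀ (diagonal b)
  have hM : fromBlocks (U * diagonal a * Uᵀ) (U * (T * Rᵀ)) (U * (T * Rᵀ))ᵀ
      (R * diagonal b * Rᵀ) = X * M₀ * Xᵀ := by
    simp [X, M₀, fromBlocks_transpose, fromBlocks_multiply, Matrix.mul_assoc, transpose_mul]
  rw [hM] at hz
  have hz' : M₀ *ᵥ (Xᵀ *ᵥ z) = x • (Xᵀ *ᵥ z) := by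
    rw [← mulVec_smul, ← hz, mulVec_mulVec, mulVec_mulVec, ← Matrix.mul_assoc, ← Matrix.mul_assoc,
      hX, Matrix.one_mul]
  have h0 : Xᵀ *ᵥ z = 0 := by
    obtain ⟨h1, h2⟩ := hspec x hx (fun v => (Xᵀ *ᵥ z) (Sum.inl v)) (fun w => (Xᵀ *ᵥ z) (Sum.inr w))
      (fun v => by
        have := congrFun hz' (Sum.inl v)
        rw [fromBlocks_mulVec, Sum.elim_inl, Pi.add_apply, mulVec_diagonal] at this
        exact this)
      (fun w => by
        have := congrFun hz' (Sum.inr w)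
        rw [fromBlocks_mulVec, Sum.elim_inr, Pi.add_apply, mulVec_diagonal] at this
        exact this)
    ext (v | w)
    · exact congrFun h1 v
    · exact congrFun h2 w
  calc z = (X * Xᵀ) *ᵥ z := by rw [mul_eq_one_comm.1 hX, one_mulVec]
    _ = 0 := by rw [← mulVec_mulVec, h0, mulVec_zero]

theorem q_join_le {G : SimpleGraph V} {H : SimpleGraph W} (hG : G.Connected)
    (hH : H.Connected) {k : ℕ} (hk : 0 < k) (hVW : Fintype.card V ≤ Fintype.card W)
    (hWV : Fintype.card W ≤ k * Fintype.card V + k + 1) : q (join G H) ≤ k + 1 := by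
  obtain ⟨M, hM, hn⟩ := exists_mem_matricesOf_join hG hH hk hVW hWV
  exact q_le_of_mem hM hn

theorem numEigenvalues_submatrix_le (e : V ≃ W) (A : Matrix W W ℝ) :
    numEigenvalues (A.submatrix e e) ≤ numEigenvalues A := by
  refine Set.ncard_le_ncard (fun x hx => ?_) (finite_eigenvalues A)
  obtain ⟨z, hz, hz0⟩ := Module.End.HasEigenvalue.exists_hasEigenvector hx
  rw [Module.End.mem_eigenspace_iff, toLin'_apply, submatrix_mulVec_equiv] at hz
  refine Module.End.hasEigenvalue_of_hasEigenvector (x := z ∘ e.symm)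
    ⟨Module.End.mem_eigenspace_iff.2 ?_, fun h => hz0 (funext fun v => ?_)⟩
  · ext w
    simpa using congrFun hz (e.symm w)
  · simpa using congrFun h (e v)

theorem q_le_of_iso {G : SimpleGraph V} {H : SimpleGraph W} (e : G ≃g H) : q G ≤ q H := by
  obtain ⟨A, hA, hq⟩ := Nat.sInf_mem ((matricesOf_nonempty H).image numEigenvalues)
  refine q_le_of_mem (A := A.submatrix e e) ⟨hA.1.submatrix e, fun i j hij => ?_⟩ ?_
  · rw [submatrix_apply, hA.2 _ _ fun h => hij (e.injective h), e.map_adj_iff]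
  · exact (numEigenvalues_submatrix_le e.toEquiv A).trans hq.le

/-- The join is commutative up to isomorphism. -/
def joinComm (G : SimpleGraph V) (H : SimpleGraph W) : join G H ≃g join H G where
  toEquiv := Equiv.sumComm V W
  map_rel_iff' := by rintro (v | w) (v' | w') <;> rfl

theorem q_join_le_ceil {G : SimpleGraph V} {H : SimpleGraph W} (hG : G.Connected)
    (hH : H.Connected) (hVW : Fintype.card V ≤ Fintype.card W) (hW : Fintype.card W ≠ 1) :
    q (join G H) ≤
      ⌈((Fintype.card V : ℝ) + (Fintype.card W : ℝ)) / ((Fintype.card V : ℝ) + 1)⌉₊ := by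
  have := hG.nonempty
  have hV : 0 < Fintype.card V := Fintype.card_pos
  set m := Fintype.card V
  set n := Fintype.card W
  have hm : (0 : ℝ) < (m : ℝ) + 1 := by positivity
  -- The ceiling is `k + 1`, so positivity of `k` requires it to exceed 1; this is where `n ≥ 2`
  -- enters.
  have hlt : 1 < ⌈((m : ℝ) + n) / ((m : ℝ) + 1)⌉₊ := by
    rw [Nat.lt_ceil, lt_div_iff₀ hm]
    have : (2 : ℝ) ≤ n := by exact_mod_cast (by omega : 2 ≤ n)
    push_cast
    linarith
  obtain ⟨k, hk⟩ : ∃ k, ⌈((m : ℝ) + n) / ((m : ℝ) + 1)⌉₊ = k + 1 := ⟨_, (Nat.sub_add_cancel hlt.le).symm⟩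
  rw [hk]
  refine q_join_le hG hH (by omega) hVW ?_
  have h1 := Nat.le_ceil (((m : ℝ) + n) / ((m : ℝ) + 1))
  rw [hk, div_le_iff₀ hm] at h1
  have h2 : m + n ≤ (k + 1) * (m + 1) := by exact_mod_cast h1
  have h3 : (k + 1) * (m + 1) = k * m + k + 1 + m := by ring
  change n ≤ k * m + k + 1
  omega

end Join
end GraphJoin

theorem theorem2p2 {V W : Type*} [Fintype V] [DecidableEq V] [Fintype W] [DecidableEq W]
    (G : SimpleGraph V) (H : SimpleGraph W) (hG : G.Connected) (hH : H.Connected) :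
    (∀ k : ℕ, 0 < k → Fintype.card V ≤ Fintype.card W →
        Fintype.card W ≤ k * Fintype.card V + k + 1 →
        GraphJoin.q (GraphJoin.join G H) ≤ k + 1) ∧
    (max (Fintype.card V) (Fintype.card W) ≠ 1 →
        GraphJoin.q (GraphJoin.join G H) ≤
          ⌈((Fintype.card V : ℝ) + (Fintype.card W : ℝ)) /
            ((min (Fintype.card V) (Fintype.card W) : ℝ) + 1)⌉₊) := by
  refine ⟨fun k hk h1 h2 => GraphJoin.q_join_le hG hH hk h1 h2, fun hmax => ?_⟩
  rcases le_total (Fintype.card V) (Fintype.card W) with h | h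
  · rw [max_eq_right h] at hmax
    rw [min_eq_left (by exact_mod_cast h)]
    exact GraphJoin.q_join_le_ceil hG hH h hmax
  · rw [max_eq_left h] at hmax
    rw [min_eq_right (by exact_mod_cast h), add_comm (Fintype.card V : ℝ)]
    exact (GraphJoin.q_le_of_iso (GraphJoin.joinComm G H)).trans
      (GraphJoin.q_join_le_ceil hH hG h hmax)
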